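/- For $x,y,z,t\in\mathbb Q$ let $circ(x,y,z)$ mean that $x\le y\le z$ or $y\le z\le x$ or $z\le x\le y$, and let $sep(x,y,z,t)$ mean that $circ(x,y,z)\wedge circ(x,t,y)$ or $circ(x,z,y)\wedge circ(x,y,t)$. For a relation $R$ on a set $A$, let $\mathrm{Pol}(A,R)$ be the clone of all operations $f\colon A^n\to A$, $n\ge 0$, that preserve $R$ (whenever $R$ holds in each coordinate of given $n$-tuples, it holds for the values of $f$ at these tuples). A clone on a set $A$ is a set of finitary operations on $A$ (arities $n\ge 0$) that contains all projections and is closed under composition; it is topologized as a subspace of the set $\mathcal O_A=\bigsqcup_{n\ge 0}A^{A^n}$ of all finitary operations on $A$, where $A$ is discrete, each $A^{A^n}$ has the product topology (pointwise convergence), and $\mathcal O_A$ is the topological sum. An isomorphism of clones is a bijection that preserves arities, projections and composition. A clone $P$ on a countable set has \emph{automatic homeomorphicity} if every clone isomorphism from $P$ onto a clone $P'$ on a countable set $\Omega$ that is closed in $\mathcal O_\Omega$ is a homeomorphism from $P$ to $P'$. \textbf{Theorem.} The polymorphism clones $\mathrm{Pol}(\mathbb Q,circ)$ and $\mathrm{Pol}(\mathbb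 Q,sep)$ have automatic homeomorphicity. -/

import Mathlib

universe u v

/-- The `n`-ary operations on a set `A`, for `n ≥ 0`. -/
def Op (A : Type u) (n : ℕ) : Type u := (Fin n → A) → A

/-- The topology of pointwise convergence on `A ^ (A ^ n)`, where `A` is discrete
(whatever other topology `A` may carry). -/
instance Op.instTopologicalSpace (A : Type u) (n : ℕ) : TopologicalSpace (Op A n) :=
  @Pi.topologicalSpace (Fin n → A) (fun _ => A) (fun _ => ⊥)

/-- The projection `(a₁, …, aₙ) ↦ aᵢ`. -/
def Op.proj (A : Type u) {n : ℕ} (i : Fin n) : Op A n := fun a => a i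

/-- The composition `f(g₁, …, gₙ)` of an `n`-ary `f` with `m`-ary `g₁, …, gₙ`. -/
def Op.comp {A : Type u} {n m : ℕ} (f : Op A n) (g : Fin n → Op A m) : Op A m :=
  fun a => f (fun i => g i a)

/-- A concrete clone on `A`: a set of finitary operations, sorted by arity, that contains the
projections and is closed under composition. -/
structure OpClone (A : Type u) where
  ops : (n : ℕ) → Set (Op A n)
  proj_mem : ∀ {n : ℕ} (i : Fin n), Op.proj A i ∈ ops n
  comp_mem : ∀ {n m : ℕ} {f : Op A n} {g : Fin n → Op A m},
    f ∈ ops n → (∀ i, g i ∈ ops m) → Op.comp f g ∈ ops m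

namespace OpClone

variable {A : Type u} {B : Type v}

/-- The clone is a closed subset of the space `Σ n, Op A n` of all finitary operations
(the topological sum over the arities). -/
def Closed (C : OpClone A) : Prop :=
  IsClosed {p : Σ n, Op A n | p.2 ∈ C.ops p.1}

/-- A clone isomorphism: an arity-preserving bijection that maps each projection to the
corresponding projection and commutes with composition. -/
structure Iso (C : OpClone A) (D : OpClone B) where
  toEquiv : (n : ℕ) → C.ops n ≃ D.ops n
  map_proj : ∀ {n : ℕ} (i : Fin n),
    toEquiv n ⟨Op.proj A i, C.proj_mem i⟩ = ⟨Op.proj B i, D.proj_mem i⟩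
  map_comp : ∀ {n m : ℕ} (f : C.ops n) (g : Fin n → C.ops m),
    toEquiv m ⟨Op.comp f.1 (fun i => (g i).1), C.comp_mem f.2 (fun i => (g i).2)⟩ =
      ⟨Op.comp (toEquiv n f).1 (fun i => (toEquiv m (g i)).1),
        D.comp_mem (toEquiv n f).2 (fun i => (toEquiv m (g i)).2)⟩

/-- The isomorphism as a map between the clones, each being the topological sum of its
`n`-ary parts. -/
def Iso.toFun {C : OpClone A} {D : OpClone B} (θ : C.Iso D) :
    (Σ n, C.ops n) → (Σ n, D.ops n) :=
  Sigma.map id fun n => θ.toEquiv n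

/-- Every isomorphism onto a closed clone on a countable set is a homeomorphism. -/
def HasAutomaticHomeomorphicity (C : OpClone A) : Prop :=
  ∀ (Ω : Type v) [Countable Ω] (D : OpClone Ω), D.Closed →
    ∀ θ : C.Iso D, IsHomeomorph θ.toFun

/-- The polymorphism clone of the structure `(A, R)`, with `R` a `k`-ary relation: `f` belongs to
it if, whenever `R` holds in each coordinate of `k` many `n`-tuples, it holds for the values of `f`
at these tuples. -/
def pol {k : ℕ} (R : (Fin k → A) → Prop) : OpClone A where
  ops n := {f | ∀ a : Fin k → Fin n → A, (∀ i, R fun j => a j i) → R fun j => f (a j)}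
  proj_mem i := fun _ h => h i
  comp_mem hf hg := fun a h => hf _ fun i => hg i a h

end OpClone

/-- The (reflexive) circular order on `ℚ`. -/
def circ (x y z : ℚ) : Prop :=
  (x ≤ y ∧ y ≤ z) ∨ (y ≤ z ∧ z ≤ x) ∨ (z ≤ x ∧ x ≤ y)

/-- The (reflexive) separation relation on `ℚ`. -/
def sep (x y z t : ℚ) : Prop :=
  (circ x y z ∧ circ x t y) ∨ (circ x z y ∧ circ x y t)

/-- `Pol(ℚ, circ)`. -/
def polCirc : OpClone ℚ :=
  OpClone.pol fun w : Fin 3 → ℚ => circ (w 0) (w 1) (w 2)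

/-- `Pol(ℚ, sep)`. -/
def polSep : OpClone ℚ :=
  OpClone.pol fun w : Fin 4 → ℚ => sep (w 0) (w 1) (w 2) (w 3)

open Set

/-! ### Gaps in countable dense linear orders -/

/-- A lower set defining a gap: a cut with both sides nonempty, without a greatest element on the
left or a least element on the right. -/
structure IsGap {α : Type*} [LinearOrder α] (L : Set α) : Prop where
  lower : IsLowerSet L
  nonempty : L.Nonempty
  compl_nonempty : Lᶜ.Nonempty
  exists_gt : ∀ a ∈ L, ∃ b ∈ L, a < b
  exists_lt : ∀ a ∉ L, ∃ b ∉ L, b < a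

namespace IsGap

variable {α β : Type*} [LinearOrder α] [LinearOrder β] {L : Set α}

lemma lt_of_mem_of_notMem (h : IsGap L) {a b : α} (ha : a ∈ L) (hb : b ∉ L) : a < b :=
  lt_of_not_ge fun hba => hb (h.lower hba ha)

lemma preimage (h : IsGap L) (e : β ≃o α) : IsGap (e ⁻¹' L) where
  lower := fun _ _ hab ha => h.lower (e.monotone hab) ha
  nonempty := by
    obtain ⟨a, ha⟩ := h.nonempty
    exact ⟨e.symm a, by simpa using ha⟩
  compl_nonempty := by
    obtain ⟨a, ha⟩ := h.compl_nonempty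
    exact ⟨e.symm a, by simpa using ha⟩
  exists_gt := by
    intro a ha
    obtain ⟨b, hb, hab⟩ := h.exists_gt _ ha
    exact ⟨e.symm b, by simpa using hb, by rwa [← e.lt_iff_lt, e.apply_symm_apply]⟩
  exists_lt := by
    intro a ha
    obtain ⟨b, hb, hab⟩ := h.exists_lt _ ha
    exact ⟨e.symm b, by simpa using hb, by rwa [← e.lt_iff_lt, e.apply_symm_apply]⟩

/-- Both sides of a gap of a countable dense order without endpoints are copies of `ℚ`. -/
lemma exists_orderIso [Countable α] [DenselyOrdered α] [NoMinOrder α] [NoMaxOrder α]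
    (h : IsGap L) : Nonempty (L ≃o ℚ) ∧ Nonempty ((Lᶜ : Set α) ≃o ℚ) := by
  have hl : L.OrdConnected := h.lower.ordConnected
  have hu : (Lᶜ).OrdConnected := h.lower.compl.ordConnected
  have := h.nonempty.to_subtype
  have := h.compl_nonempty.to_subtype
  have : NoMaxOrder L := ⟨fun a => by
    obtain ⟨b, hb, hab⟩ := h.exists_gt a.1 a.2
    exact ⟨⟨b, hb⟩, hab⟩⟩
  have : NoMinOrder L := ⟨fun a => by
    obtain ⟨b, hb⟩ := NoMinOrder.exists_lt a.1
    exact ⟨⟨b, h.lower hb.le a.2⟩, hb⟩⟩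
  have : NoMinOrder (Lᶜ : Set α) := ⟨fun a => by
    obtain ⟨b, hb, hab⟩ := h.exists_lt a.1 a.2
    exact ⟨⟨b, hb⟩, hab⟩⟩
  have : NoMaxOrder (Lᶜ : Set α) := ⟨fun a => by
    obtain ⟨b, hb⟩ := NoMaxOrder.exists_gt a.1
    exact ⟨⟨b, h.lower.compl hb.le a.2⟩, hb⟩⟩
  exact ⟨Order.iso_of_countable_dense _ _, Order.iso_of_countable_dense _ _⟩

/-- Every gap of `ℚ` looks like the gap in the middle of `ℚ ⊕ₗ ℚ`. -/
lemma exists_sumLex_orderIso {L : Set ℚ} (h : IsGap L) :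
    ∃ Ψ : (ℚ ⊕ₗ ℚ) ≃o ℚ, (∀ v, Ψ (Sum.inlₗ v) ∈ L) ∧ ∀ v, Ψ (Sum.inrₗ v) ∉ L := by
  obtain ⟨⟨φ⟩, ⟨χ⟩⟩ := h.exists_orderIso
  let f : ℚ ⊕ₗ ℚ → ℚ := fun u =>
    Sum.elim (fun v => (φ.symm v : ℚ)) (fun v => (χ.symm v : ℚ)) (ofLex u)
  have hf : StrictMono f := by
    rintro (a | a) (b | b) hab
    · exact φ.symm.strictMono (Sum.Lex.inl_lt_inl_iff.1 hab)
    · exact h.lt_of_mem_of_notMem (φ.symm a).2 (χ.symm b).2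
    · exact absurd hab Sum.Lex.not_inr_lt_inl
    · exact χ.symm.strictMono (Sum.Lex.inr_lt_inr_iff.1 hab)
  have hs : Function.Surjective f := by
    intro q
    by_cases hq : q ∈ L
    · exact ⟨Sum.inlₗ (φ ⟨q, hq⟩), by simp [f]⟩
    · exact ⟨Sum.inrₗ (χ ⟨q, hq⟩), by simp [f]⟩
  exact ⟨hf.orderIsoOfSurjective f hs, fun v => (φ.symm v).2, fun v => (χ.symm v).2⟩

end IsGap

lemma isGap_rat_lt {y : ℝ} (hy : Irrational y) : IsGap {p : ℚ | (p : ℝ) < y} where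
  lower := fun a b hab (ha : (a : ℝ) < y) => lt_of_le_of_lt (by exact_mod_cast hab) ha
  nonempty := exists_rat_lt y
  compl_nonempty := by
    obtain ⟨q, hq⟩ := exists_rat_gt y
    exact ⟨q, fun h : (q : ℝ) < y => lt_asymm h hq⟩
  exists_gt := by
    intro a ha
    obtain ⟨q, h1, h2⟩ := exists_rat_btwn (show (a : ℝ) < y from ha)
    exact ⟨q, h2, by exact_mod_cast h1⟩
  exists_lt := by
    intro a ha
    have ha : y < a := lt_of_le_of_ne (not_lt.1 ha) fun h => hy ⟨a, h.symm⟩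
    obtain ⟨q, h1, h2⟩ := exists_rat_btwn ha
    exact ⟨q, fun h : (q : ℝ) < y => lt_asymm h h1, by exact_mod_cast h2⟩

lemma exists_prodLex_orderIso : Nonempty ((ℚ ×ₗ ℚ) ≃o ℚ) :=
  have : Countable (ℚ ×ₗ ℚ) := inferInstanceAs (Countable (ℚ × ℚ))
  Order.iso_of_countable_dense _ _

/-! ### A discrete grid in `ℚ ⊕ₗ ℚ` accumulating only at the middle gap -/

namespace SumGrid

/-- The left half of `ℚ ⊕ₗ ℚ`. -/
def left : Set (ℚ ⊕ₗ ℚ) := range Sum.inlₗ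

/-- The largest grid point below `u`. -/
def floor (u : ℚ ⊕ₗ ℚ) : ℚ ⊕ₗ ℚ :=
  toLex ((ofLex u).map (fun v => (⌊v⌋ : ℚ)) (fun v => (⌊v⌋ : ℚ)))

/-- The least grid point strictly above `u`. -/
def next (u : ℚ ⊕ₗ ℚ) : ℚ ⊕ₗ ℚ :=
  toLex ((ofLex u).map (fun v => (⌊v⌋ + 1 : ℚ)) (fun v => (⌊v⌋ + 1 : ℚ)))

@[simp] lemma floor_inl (v : ℚ) : floor (Sum.inlₗ v) = Sum.inlₗ (⌊v⌋ : ℚ) := rfl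
@[simp] lemma floor_inr (v : ℚ) : floor (Sum.inrₗ v) = Sum.inrₗ (⌊v⌋ : ℚ) := rfl
@[simp] lemma next_inl (v : ℚ) : next (Sum.inlₗ v) = Sum.inlₗ (⌊v⌋ + 1 : ℚ) := rfl
@[simp] lemma next_inr (v : ℚ) : next (Sum.inrₗ v) = Sum.inrₗ (⌊v⌋ + 1 : ℚ) := rfl

lemma cases_inl_inr (u : ℚ ⊕ₗ ℚ) : (∃ v, u = Sum.inlₗ v) ∨ ∃ v, u = Sum.inrₗ v := by
  rcases u with v | v
  exacts [Or.inl ⟨v, rfl⟩, Or.inr ⟨v, rfl⟩]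

lemma inl_le_inl {a b : ℚ} : (Sum.inlₗ a : ℚ ⊕ₗ ℚ) ≤ Sum.inlₗ b ↔ a ≤ b := Sum.Lex.inl_le_inl_iff
lemma inr_le_inr {a b : ℚ} : (Sum.inrₗ a : ℚ ⊕ₗ ℚ) ≤ Sum.inrₗ b ↔ a ≤ b := Sum.Lex.inr_le_inr_iff
lemma inl_lt_inl {a b : ℚ} : (Sum.inlₗ a : ℚ ⊕ₗ ℚ) < Sum.inlₗ b ↔ a < b := Sum.Lex.inl_lt_inl_iff
lemma inr_lt_inr {a b : ℚ} : (Sum.inrₗ a : ℚ ⊕ₗ ℚ) < Sum.inrₗ b ↔ a < b := Sum.Lex.inr_lt_inr_iff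
lemma inl_lt_inr (a b : ℚ) : (Sum.inlₗ a : ℚ ⊕ₗ ℚ) < Sum.inrₗ b := Sum.Lex.inl_lt_inr a b

lemma inr_notMem_left (v : ℚ) : Sum.inrₗ v ∉ left := by
  rintro ⟨w, hw⟩
  exact (inl_lt_inr w v).ne hw

lemma monotone_floor : Monotone floor := by
  intro u u' h
  obtain ⟨v, rfl⟩ | ⟨v, rfl⟩ := cases_inl_inr u <;>
    obtain ⟨v', rfl⟩ | ⟨v', rfl⟩ := cases_inl_inr u'
  · rw [floor_inl, floor_inl, inl_le_inl]
    exact_mod_cast Int.floor_le_floor (inl_le_inl.1 h)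
  · exact (inl_lt_inr _ _).le
  · exact absurd h (inl_lt_inr _ _).not_ge
  · rw [floor_inr, floor_inr, inr_le_inr]
    exact_mod_cast Int.floor_le_floor (inr_le_inr.1 h)

lemma floor_le (u : ℚ ⊕ₗ ℚ) : floor u ≤ u := by
  obtain ⟨v, rfl⟩ | ⟨v, rfl⟩ := cases_inl_inr u
  · exact inl_le_inl.2 (Int.floor_le v)
  · exact inr_le_inr.2 (Int.floor_le v)

lemma lt_next (u : ℚ ⊕ₗ ℚ) : u < next u := by
  obtain ⟨v, rfl⟩ | ⟨v, rfl⟩ := cases_inl_inr u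
  · exact inl_lt_inl.2 (Int.lt_floor_add_one v)
  · exact inr_lt_inr.2 (Int.lt_floor_add_one v)

@[simp] lemma floor_floor (u : ℚ ⊕ₗ ℚ) : floor (floor u) = floor u := by
  obtain ⟨v, rfl⟩ | ⟨v, rfl⟩ := cases_inl_inr u <;> simp

@[simp] lemma next_floor (u : ℚ ⊕ₗ ℚ) : next (floor u) = next u := by
  obtain ⟨v, rfl⟩ | ⟨v, rfl⟩ := cases_inl_inr u <;> simp

lemma next_le_floor {u u' : ℚ ⊕ₗ ℚ} (h : floor u < floor u') : next u ≤ floor u' := by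
  obtain ⟨v, rfl⟩ | ⟨v, rfl⟩ := cases_inl_inr u <;>
    obtain ⟨v', rfl⟩ | ⟨v', rfl⟩ := cases_inl_inr u'
  · rw [floor_inl, floor_inl, inl_lt_inl] at h
    rw [next_inl, floor_inl, inl_le_inl]
    exact_mod_cast h
  · exact (inl_lt_inr _ _).le
  · exact absurd h (inl_lt_inr _ _).not_gt
  · rw [floor_inr, floor_inr, inr_lt_inr] at h
    rw [next_inr, floor_inr, inr_le_inr]
    exact_mod_cast h

lemma next_eq_of_floor_eq {u u' : ℚ ⊕ₗ ℚ} (h : floor u = floor u') : next u = next u' := by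
  rw [← next_floor u, h, next_floor]

/-- Grid points approach the middle gap from the left. -/
lemma exists_lt_floor {a : ℚ ⊕ₗ ℚ} (ha : a ∈ left) : ∃ u ∈ left, a < floor u := by
  obtain ⟨v, rfl⟩ := ha
  refine ⟨Sum.inlₗ (v + 1), ⟨_, rfl⟩, ?_⟩
  rw [floor_inl, inl_lt_inl, Int.floor_add_one]
  push_cast
  exact Int.lt_floor_add_one v

lemma exists_consecutive {P : ℚ → Prop} (hP : ∀ a b, a ≤ b → P b → P a) (h1 : ∃ a, P a)
    (h2 : ∃ a, ¬ P a) : ∃ n : ℤ, P n ∧ ¬ P (n + 1) := by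
  obtain ⟨a, ha⟩ := h1
  obtain ⟨b, hb⟩ := h2
  obtain ⟨n, hn, hmax⟩ := Int.exists_greatest_of_bdd (P := fun n : ℤ => P n)
    ⟨⌈b⌉, fun z hz => by
      by_contra hlt
      exact hb (hP _ _ ((Int.le_ceil b).trans (by exact_mod_cast (not_le.1 hlt).le)) hz)⟩
    ⟨⌊a⌋, hP _ _ (Int.floor_le a) ha⟩
  refine ⟨n, hn, fun h => ?_⟩
  have := hmax (n + 1) (by exact_mod_cast h)
  omega

/-- The grid is discrete at every gap but the middle one. -/
lemma exists_floor_mem_next_notMem {L : Set (ℚ ⊕ₗ ℚ)} (hL : IsGap L) (hne : L ≠ left) :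
    ∃ u, floor u ∈ L ∧ next u ∉ L := by
  by_cases h : ∀ v, Sum.inlₗ v ∈ L
  · have h1 : ∃ v, Sum.inrₗ v ∈ L := by
      by_contra! h1
      refine hne (Set.ext fun u => ?_)
      obtain ⟨v, rfl⟩ | ⟨v, rfl⟩ := cases_inl_inr u
      · exact ⟨fun _ => ⟨_, rfl⟩, fun _ => h v⟩
      · exact ⟨fun hv => absurd hv (h1 v), fun hv => absurd hv (inr_notMem_left v)⟩
    have h2 : ∃ v, Sum.inrₗ v ∉ L := by
      obtain ⟨u, hu⟩ := hL.compl_nonempty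
      obtain ⟨v, rfl⟩ | ⟨v, rfl⟩ := cases_inl_inr u
      · exact absurd (h v) hu
      · exact ⟨v, hu⟩
    obtain ⟨n, hn, hn'⟩ := exists_consecutive (P := fun v => Sum.inrₗ v ∈ L)
      (fun a b hab => hL.lower (inr_le_inr.2 hab)) h1 h2
    exact ⟨Sum.inrₗ n, by simpa using hn, by simpa using hn'⟩
  · push Not at h
    have h1 : ∃ v, Sum.inlₗ v ∈ L := by
      obtain ⟨u, hu⟩ := hL.nonempty
      obtain ⟨v, rfl⟩ | ⟨v, rfl⟩ := cases_inl_inr u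
      · exact ⟨v, hu⟩
      · exact ⟨0, hL.lower (inl_lt_inr _ _).le hu⟩
    obtain ⟨n, hn, hn'⟩ := exists_consecutive (P := fun v => Sum.inlₗ v ∈ L)
      (fun a b hab => hL.lower (inl_le_inl.2 hab)) h1 h
    exact ⟨Sum.inlₗ n, by simpa using hn, by simpa using hn'⟩

end SumGrid

/-! ### Endomorphisms of the circular order -/

/-- The monoid of endomorphisms of `(ℚ, circ)`. -/
def circEnd : Submonoid (Function.End ℚ) where
  carrier := {f | ∀ x y z, circ x y z → circ (f x) (f y) (f z)}
  one_mem' := fun _ _ _ h => h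
  mul_mem' := fun hf hg _ _ _ h => hf _ _ _ (hg _ _ _ h)

namespace circEnd

/-- A monotone map as an endomorphism of the circular order. -/
def ofMonotone (f : ℚ → ℚ) (hf : Monotone f) : circEnd :=
  ⟨f, by
    rintro x y z (⟨h, h'⟩ | ⟨h, h'⟩ | ⟨h, h'⟩)
    · exact Or.inl ⟨hf h, hf h'⟩
    · exact Or.inr (Or.inl ⟨hf h, hf h'⟩)
    · exact Or.inr (Or.inr ⟨hf h, hf h'⟩)⟩

/-- There is an involution of the circular order that exchanges the two sides of the cut at `√2`. -/
lemma exists_rotation : ∃ ρ : circEnd, ρ * ρ = 1 ∧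
    (∀ x y : ℚ, (x : ℝ) < √2 → (y : ℝ) < √2 → x < y → ρ.1 x < ρ.1 y) ∧
    (∀ x y : ℚ, ¬ (x : ℝ) < √2 → ¬ (y : ℝ) < √2 → x < y → ρ.1 x < ρ.1 y) ∧
    ∀ x : ℚ, (ρ.1 x : ℝ) < √2 ↔ ¬ (x : ℝ) < √2 := by
  have hL := isGap_rat_lt irrational_sqrt_two
  set L : Set ℚ := {p : ℚ | (p : ℝ) < √2} with hLdef
  obtain ⟨⟨φ⟩, ⟨χ⟩⟩ := hL.exists_orderIso
  let α : L ≃o (Lᶜ : Set ℚ) := φ.trans χ.symm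
  classical
  let f : ℚ → ℚ := fun x => if h : x ∈ L then α ⟨x, h⟩ else α.symm ⟨x, h⟩
  have f1 : ∀ x (h : x ∈ L), f x = α ⟨x, h⟩ := fun x h => dif_pos h
  have f2 : ∀ x (h : x ∉ L), f x = α.symm ⟨x, h⟩ := fun x h => dif_neg h
  have m1 : ∀ x y, x ∈ L → y ∈ L → x < y → f x < f y := by
    intro x y hx hy h
    rw [f1 x hx, f1 y hy]
    exact α.strictMono (show (⟨x, hx⟩ : L) < ⟨y, hy⟩ from h)
  have m2 : ∀ x y, x ∉ L → y ∉ L → x < y → f x < f y := by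
    intro x y hx hy h
    rw [f2 x hx, f2 y hy]
    exact α.symm.strictMono (show (⟨x, hx⟩ : (Lᶜ : Set ℚ)) < ⟨y, hy⟩ from h)
  have s1 : ∀ x, x ∈ L → f x ∉ L := fun x h => by rw [f1 x h]; exact (α ⟨x, h⟩).2
  have s2 : ∀ x, x ∉ L → f x ∈ L := fun x h => by rw [f2 x h]; exact (α.symm ⟨x, h⟩).2
  have n1 : ∀ x y, x ∈ L → y ∈ L → x ≤ y → f x ≤ f y := fun x y hx hy h =>
    h.eq_or_lt.elim (fun h => h ▸ le_rfl) fun h => (m1 x y hx hy h).le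
  have n2 : ∀ x y, x ∉ L → y ∉ L → x ≤ y → f x ≤ f y := fun x y hx hy h =>
    h.eq_or_lt.elim (fun h => h ▸ le_rfl) fun h => (m2 x y hx hy h).le
  have n3 : ∀ x y, x ∈ L → y ∉ L → f y ≤ f x := fun x y hx hy =>
    (hL.lt_of_mem_of_notMem (s2 y hy) (s1 x hx)).le
  have n4 : ∀ x y, x ∈ L → y ∉ L → ¬ y ≤ x := fun x y hx hy =>
    (hL.lt_of_mem_of_notMem hx hy).not_ge
  have hf : ∀ x y z, circ x y z → circ (f x) (f y) (f z) := by
    intro x y z h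
    unfold circ at h ⊢
    by_cases hx : x ∈ L <;> by_cases hy : y ∈ L <;> by_cases hz : z ∈ L <;> grind
  refine ⟨⟨f, hf⟩, Subtype.ext (funext fun x => ?_), m1, m2, fun x => ?_⟩
  · change f (f x) = x
    by_cases h : x ∈ L
    · rw [f2 _ (s1 x h)]
      simp [f1 x h]
    · rw [f1 _ (s2 x h)]
      simp [f2 x h]
  · exact ⟨fun h h' => s1 x h' h, s2 x⟩

end circEnd

lemma monotone_collapse {α : Type*} [LinearOrder α] {V : Set α} (hV : V.OrdConnected) {c : α}
    (hc : c ∈ V) [DecidablePred (· ∈ V)] : Monotone fun x => if x ∈ V then c else x := by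
  intro x y h
  by_cases hx : x ∈ V <;> by_cases hy : y ∈ V <;> simp only [hx, hy, if_true, if_false]
  · exact le_rfl
  · by_contra hlt
    exact hy (hV.out hx hc ⟨h, (not_le.1 hlt).le⟩)
  · by_contra hlt
    exact hx (hV.out hc hy ⟨(not_le.1 hlt).le, h⟩)
  · exact h

/-! ### Sets that an element of a `circEnd`-set does not depend on -/

section Action

variable {Ω : Type v} [MulAction circEnd Ω]

/-- `w` is fixed by an endomorphism that maps `V` into a finite set, and moves points only into
that finite set. -/
def Collapsible (w : Ω) (V : Set ℚ) : Prop :=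
  ∃ e : circEnd, e • w = w ∧ ∃ Φ : Set ℚ, Φ.Finite ∧ (∀ x, e.1 x = x ∨ e.1 x ∈ Φ) ∧
    ∀ x ∈ V, e.1 x ∈ Φ

namespace Collapsible

variable {w : Ω} {V W : Set ℚ}

lemma mono (h : Collapsible w V) (hWV : W ⊆ V) : Collapsible w W := by
  obtain ⟨e, he, Φ, hΦ, h1, h2⟩ := h
  exact ⟨e, he, Φ, hΦ, h1, fun x hx => h2 x (hWV hx)⟩

lemma of_finite (hV : V.Finite) : Collapsible w V :=
  ⟨1, one_smul _ _, V, hV, fun _ => Or.inl rfl, fun _ hx => hx⟩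

lemma union (hV : Collapsible w V) (hW : Collapsible w W) : Collapsible w (V ∪ W) := by
  obtain ⟨e, he, Φ, hΦ, h1, h2⟩ := hV
  obtain ⟨e', he', Φ', hΦ', h1', h2'⟩ := hW
  refine ⟨e * e', by rw [mul_smul, he', he], Φ ∪ e.1 '' Φ', hΦ.union (hΦ'.image _), ?_, ?_⟩
  · intro x
    change e.1 (e'.1 x) = x ∨ e.1 (e'.1 x) ∈ _
    rcases h1' x with h | h
    · rw [h]
      exact (h1 x).imp_right Or.inl
    · exact Or.inr (Or.inr ⟨_, h, rfl⟩)
  · intro x hx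
    change e.1 (e'.1 x) ∈ _
    rcases h1' x with h | h
    · rcases hx with hx | hx
      · rw [h]
        exact Or.inl (h2 x hx)
      · exact Or.inr ⟨_, h2' x hx, rfl⟩
    · exact Or.inr ⟨_, h, rfl⟩

/-- Collapsibility pulls back along split embeddings. -/
lemma preimage {f t : circEnd} (htf : t * f = 1) (h : Collapsible (f • w) V) :
    Collapsible w (f.1 ⁻¹' V) := by
  obtain ⟨e, he, Φ, hΦ, h1, h2⟩ := h
  refine ⟨t * e * f, by rw [mul_smul, mul_smul, he, ← mul_smul, htf, one_smul],
    t.1 '' Φ, hΦ.image _, fun x => ?_, fun x hx => ⟨_, h2 _ hx, rfl⟩⟩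
  rcases h1 (f.1 x) with h | h
  · left
    change t.1 (e.1 (f.1 x)) = x
    rw [h]
    exact congrFun (congrArg Subtype.val htf) x
  · exact Or.inr ⟨_, h, rfl⟩

end Collapsible

end Action

/-! ### Spreading `ℚ` along the grid -/

namespace SumGrid

variable (Ψ Ξ : (ℚ ⊕ₗ ℚ) ≃o ℚ)

/-- The embedding that puts the block of `ℚ` between two neighbouring grid points (in the
coordinates `Ψ`) into the fibre over the lower of them (in the coordinates `Ξ`). -/
def spread (u : ℚ) : ℚ ×ₗ ℚ := toLex (Ξ (floor (Ψ.symm u)), u)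

open Classical in
/-- A monotone left inverse of `spread`. -/
noncomputable def unspread (p : ℚ ×ₗ ℚ) : ℚ :=
  if floor (Ξ.symm (ofLex p).1) = Ξ.symm (ofLex p).1 then
    max (Ψ (Ξ.symm (ofLex p).1)) (min (ofLex p).2 (Ψ (next (Ξ.symm (ofLex p).1))))
  else Ψ (next (Ξ.symm (ofLex p).1))

lemma monotone_spread : Monotone (spread Ψ Ξ) := by
  intro u u' h
  rw [Prod.Lex.le_iff]
  have : Ξ (floor (Ψ.symm u)) ≤ Ξ (floor (Ψ.symm u')) :=
    Ξ.monotone (monotone_floor (Ψ.symm.monotone h))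
  exact this.lt_or_eq.imp id fun e => ⟨e, h⟩

lemma unspread_spread (u : ℚ) : unspread Ψ Ξ (spread Ψ Ξ u) = u := by
  have h1 : Ψ (floor (Ψ.symm u)) ≤ u := by
    rw [← Ψ.le_symm_apply]
    exact floor_le _
  have h2 : u ≤ Ψ (next (Ψ.symm u)) := by
    rw [← Ψ.symm_apply_le]
    exact (lt_next _).le
  simp [unspread, spread, h1, h2]

lemma unspread_le (p : ℚ ×ₗ ℚ) : unspread Ψ Ξ p ≤ Ψ (next (Ξ.symm (ofLex p).1)) := by
  unfold unspread
  split_ifs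
  · exact max_le (Ψ.monotone (lt_next _).le) (min_le_right _ _)
  · exact le_rfl

lemma le_unspread (p : ℚ ×ₗ ℚ) : Ψ (Ξ.symm (ofLex p).1) ≤ unspread Ψ Ξ p := by
  unfold unspread
  split_ifs
  · exact le_max_left _ _
  · exact Ψ.monotone (lt_next _).le

lemma monotone_unspread : Monotone (unspread Ψ Ξ) := by
  intro p p' h
  rcases Prod.Lex.le_iff.1 h with h | ⟨h, h'⟩
  · have hlt : Ξ.symm (ofLex p).1 < Ξ.symm (ofLex p').1 := Ξ.symm.strictMono h
    rcases (monotone_floor hlt.le).lt_or_eq with hf | hf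
    · exact (unspread_le Ψ Ξ p).trans ((Ψ.monotone ((next_le_floor hf).trans (floor_le _))).trans
        (le_unspread Ψ Ξ p'))
    · have hne : floor (Ξ.symm (ofLex p').1) ≠ Ξ.symm (ofLex p').1 := by
        intro he
        rw [he] at hf
        exact absurd (hf ▸ floor_le (Ξ.symm (ofLex p).1)) hlt.not_ge
      refine (unspread_le Ψ Ξ p).trans ?_
      rw [unspread, if_neg hne, next_eq_of_floor_eq hf]
  · unfold unspread
    rw [h]
    split_ifs
    · exact max_le_max le_rfl (min_le_min h' le_rfl)
    · exact le_rfl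

end SumGrid

/-! ### Collapsing a neighbourhood of a gap -/

section Action

variable {Ω : Type v} [MulAction circEnd Ω] [Countable Ω]

lemma uncountable_irrational : ¬ Countable {y : ℝ // Irrational y} := by
  intro h
  have h1 : {y : ℝ | Irrational y}.Countable := h
  have h2 : (range ((↑) : ℚ → ℝ)).Countable := countable_range _
  refine not_countable_univ (α := ℝ) ((h1.union h2).mono fun y _ => ?_)
  by_cases hy : y ∈ range ((↑) : ℚ → ℝ)
  exacts [Or.inr hy, Or.inl hy]

open SumGrid in
open Classical in
theorem IsGap.exists_collapsible {L : Set ℚ} (hL : IsGap L) (w : Ω) :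
    ∃ a ∈ L, ∃ b ∉ L, Collapsible w (Ioo a b) := by
  obtain ⟨Ψ, hΨl, hΨr⟩ := hL.exists_sumLex_orderIso
  obtain ⟨τ⟩ := exists_prodLex_orderIso
  choose Ξ hΞl hΞr using fun y : {y : ℝ // Irrational y} =>
    (isGap_rat_lt y.2).exists_sumLex_orderIso
  have hΞ : ∀ y u, (Ξ y u : ℝ) < y.1 ↔ u ∈ left := by
    intro y u
    obtain ⟨v, rfl⟩ | ⟨v, rfl⟩ := cases_inl_inr u
    · exact ⟨fun _ => ⟨v, rfl⟩, fun _ => hΞl y v⟩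
    · exact ⟨fun h => absurd h (hΞr y v), fun h => absurd h (inr_notMem_left v)⟩
  let s : {y : ℝ // Irrational y} → circEnd := fun y =>
    circEnd.ofMonotone (fun u => τ (spread Ψ (Ξ y) u)) (τ.monotone.comp (monotone_spread _ _))
  let t : {y : ℝ // Irrational y} → circEnd := fun y =>
    circEnd.ofMonotone (fun u => unspread Ψ (Ξ y) (τ.symm u))
      ((monotone_unspread _ _).comp τ.symm.monotone)
  have hts : ∀ y, t y * s y = 1 := fun y => Subtype.ext (funext fun u => by
    change unspread Ψ (Ξ y) (τ.symm (τ (spread Ψ (Ξ y) u))) = u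
    rw [τ.symm_apply_apply, unspread_spread])
  obtain ⟨x, y, hxy, hne⟩ : ∃ x y, s x • w = s y • w ∧ x ≠ y := by
    by_contra! h
    exact uncountable_irrational (Function.Injective.countable (f := fun y => s y • w)
      fun x y hxy => h x y hxy)
  -- a neighbourhood `(a, b)` of the gap `x` that contains no grid point for `y`
  obtain ⟨a, b, ha, hb, hab⟩ : ∃ a b : ℚ, (a : ℝ) < x.1 ∧ x.1 < b ∧
      ∀ u, ¬ (a < Ξ y (floor u) ∧ Ξ y (floor u) < b) := by
    obtain ⟨u, h1, h2⟩ := exists_floor_mem_next_notMem ((isGap_rat_lt x.2).preimage (Ξ y)) (by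
      intro h
      have key : ∀ p : ℚ, (p : ℝ) < x.1 ↔ (p : ℝ) < y.1 := fun p => by
        have := Set.ext_iff.1 h ((Ξ y).symm p)
        rw [← hΞ y] at this
        simpa using this
      rcases lt_or_gt_of_ne (fun h => hne (Subtype.ext h) : x.1 ≠ y.1) with h | h
      · obtain ⟨p, h1, h2⟩ := exists_rat_btwn h
        exact lt_asymm h1 ((key p).2 h2)
      · obtain ⟨p, h1, h2⟩ := exists_rat_btwn h
        exact lt_asymm h1 ((key p).1 h2))
    refine ⟨Ξ y (floor u), Ξ y (next u), h1,
      lt_of_le_of_ne (not_lt.1 h2) fun h => x.2 ⟨_, h.symm⟩, ?_⟩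
    rintro v ⟨h3, h4⟩
    exact ((next_le_floor ((Ξ y).lt_iff_lt.1 h3)).trans_lt ((Ξ y).lt_iff_lt.1 h4)).false
  let I : Set ℚ := {u | a < Ξ x (floor (Ψ.symm u)) ∧ Ξ x (floor (Ψ.symm u)) < b}
  let J : Set ℚ := {z | a < (ofLex (τ.symm z)).1 ∧ (ofLex (τ.symm z)).1 < b}
  have monoI : Monotone fun u => Ξ x (floor (Ψ.symm u)) :=
    (Ξ x).monotone.comp (monotone_floor.comp Ψ.symm.monotone)
  have monoJ : Monotone fun z => (ofLex (τ.symm z)).1 := fun z z' h =>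
    (Prod.Lex.le_iff.1 (τ.symm.monotone h)).elim le_of_lt fun h => h.1.le
  have hI : I.OrdConnected := ordConnected_Ioo.preimage_mono monoI
  have hJ : J.OrdConnected := ordConnected_Ioo.preimage_mono monoJ
  have memJ : ∀ z u, (s z).1 u ∈ J ↔ a < Ξ z (floor (Ψ.symm u)) ∧ Ξ z (floor (Ψ.symm u)) < b := by
    intro z u
    change τ (spread Ψ (Ξ z) u) ∈ J ↔ _
    simp only [J, mem_ofPred_eq, τ.symm_apply_apply]
    rfl
  -- `I` is a neighbourhood of the gap `L`
  obtain ⟨c, hc, hcI⟩ : ∃ c ∈ left, ∀ u, c ≤ Ψ.symm u → a < Ξ x (floor (Ψ.symm u)) := by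
    have : (Ξ x).symm a ∈ left := by rw [← hΞ x]; simpa using ha
    obtain ⟨c, hc, hac⟩ := exists_lt_floor this
    refine ⟨c, hc, fun u hu => ?_⟩
    rw [← (Ξ x).symm_apply_lt]
    exact hac.trans_le (monotone_floor hu)
  have hd : (Ξ x).symm b ∉ left := by
    rw [← hΞ x]
    simpa using hb.le
  have hdI : ∀ u, Ψ.symm u < (Ξ x).symm b → Ξ x (floor (Ψ.symm u)) < b := by
    intro u hu
    rw [← (Ξ x).lt_symm_apply]
    exact (floor_le _).trans_lt hu
  have hΨL : ∀ u, Ψ u ∈ L ↔ u ∈ left := by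
    intro u
    obtain ⟨v, rfl⟩ | ⟨v, rfl⟩ := cases_inl_inr u
    · exact ⟨fun _ => ⟨v, rfl⟩, fun _ => hΨl v⟩
    · exact ⟨fun h => absurd h (hΨr v), fun h => absurd h (inr_notMem_left v)⟩
  have hcL : Ψ c ∈ L := (hΨL c).2 hc
  have hdL : Ψ ((Ξ x).symm b) ∉ L := fun h => hd ((hΨL _).1 h)
  have hsub : Ico (Ψ c) (Ψ ((Ξ x).symm b)) ⊆ I := fun u hu =>
    ⟨hcI u (Ψ.le_symm_apply.2 hu.1), hdI u (Ψ.symm_apply_lt.2 hu.2)⟩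
  have hcI' : Ψ c ∈ I := hsub ⟨le_rfl, hL.lt_of_mem_of_notMem hcL hdL⟩
  have hcJ : (s x).1 (Ψ c) ∈ J := (memJ x _).2 hcI'
  let k : circEnd := circEnd.ofMonotone _ (monotone_collapse hI hcI')
  let k' : circEnd := circEnd.ofMonotone _ (monotone_collapse hJ hcJ)
  have hk : ∀ u, k.1 u = if u ∈ I then Ψ c else u := fun u => rfl
  have hk' : ∀ u, k'.1 u = if u ∈ J then (s x).1 (Ψ c) else u := fun u => rfl
  have e1 : k' * s y = s y := Subtype.ext (funext fun u => by
    change k'.1 ((s y).1 u) = (s y).1 u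
    rw [hk', if_neg]
    rw [memJ]
    exact hab _)
  have e2 : k' * s x = s x * k := Subtype.ext (funext fun u => by
    change k'.1 ((s x).1 u) = (s x).1 (k.1 u)
    rw [hk', hk]
    by_cases hu : u ∈ I
    · rw [if_pos hu, if_pos ((memJ x u).2 hu)]
    · rw [if_neg hu, if_neg fun h => hu ((memJ x u).1 h)])
  have e3 : k • w = w := by
    have : s x • k • w = s x • w := by
      rw [← mul_smul, ← e2, mul_smul, hxy, ← mul_smul, e1]
    calc k • w = t x • s x • k • w := by rw [← mul_smul (t x), hts, one_smul]
      _ = t x • s x • w := by rw [this]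
      _ = w := by rw [← mul_smul, hts, one_smul]
  refine ⟨Ψ c, hcL, _, hdL, k, e3, {Ψ c}, finite_singleton _, fun u => ?_, fun u hu => ?_⟩
  · rw [hk]
    by_cases hu : u ∈ I
    · exact Or.inr (if_pos hu)
    · exact Or.inl (if_neg hu)
  · rw [hk, if_pos (hsub ⟨hu.1.le, hu.2⟩)]
    rfl

/-- A cut of `ℚ` becomes a gap after every point has been blown up to a copy of `ℚ`. -/
lemma isGap_fst_mem {K : Set ℚ} (hK : IsLowerSet K) (h1 : K.Nonempty) (h2 : Kᶜ.Nonempty) :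
    IsGap {p : ℚ ×ₗ ℚ | (ofLex p).1 ∈ K} where
  lower := fun _ _ hqp hp => hK ((Prod.Lex.le_iff.1 hqp).elim le_of_lt fun h => h.1.le) hp
  nonempty := h1.imp' (fun p => toLex (p, 0)) fun _ h => h
  compl_nonempty := h2.imp' (fun p => toLex (p, 0)) fun _ h => h
  exists_gt := fun p hp => ⟨toLex ((ofLex p).1, (ofLex p).2 + 1), hp,
    Prod.Lex.lt_iff.2 (Or.inr ⟨rfl, lt_add_one _⟩)⟩
  exists_lt := fun p hp => ⟨toLex ((ofLex p).1, (ofLex p).2 - 1), hp,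
    Prod.Lex.lt_iff.2 (Or.inr ⟨rfl, sub_one_lt _⟩)⟩

theorem exists_collapsible_of_isLowerSet {K : Set ℚ} (hK : IsLowerSet K) (h1 : K.Nonempty)
    (h2 : Kᶜ.Nonempty) (w : Ω) :
    ∃ a ∈ K, ∃ b ∉ K, Collapsible w {q | a < q ∧ q < b} := by
  obtain ⟨τ⟩ := exists_prodLex_orderIso
  have hfst : Monotone fun z => (ofLex (τ.symm z)).1 := fun z z' h =>
    (Prod.Lex.le_iff.1 (τ.symm.monotone h)).elim le_of_lt fun h => h.1.le
  have hinc : Monotone fun q : ℚ => τ (toLex (q, 0)) := fun q q' h =>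
    τ.monotone (Prod.Lex.le_iff.2 (h.lt_or_eq.imp id fun h => ⟨h, le_rfl⟩))
  let f : circEnd := circEnd.ofMonotone _ hinc
  let t : circEnd := circEnd.ofMonotone _ hfst
  have htf : t * f = 1 := Subtype.ext (funext fun q => by
    change (ofLex (τ.symm (τ (toLex (q, 0))))).1 = q
    rw [τ.symm_apply_apply]
    rfl)
  obtain ⟨a, ha, b, hb, hab⟩ :=
    ((isGap_fst_mem hK h1 h2).preimage τ.symm).exists_collapsible (f • w)
  refine ⟨(ofLex (τ.symm a)).1, ha, (ofLex (τ.symm b)).1, hb, (hab.preimage htf).mono ?_⟩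
  rintro q ⟨h3, h4⟩
  have h3' : τ.symm a < toLex (q, 0) := Prod.Lex.lt_iff.2 (Or.inl h3)
  have h4' : toLex (q, 0) < τ.symm b := Prod.Lex.lt_iff.2 (Or.inl h4)
  exact ⟨τ.symm_apply_lt.1 h3', τ.lt_symm_apply.1 h4'⟩

theorem exists_collapsible_at_infinity (w : Ω) :
    ∃ a b : ℚ, Collapsible w ({q | q < a} ∪ {q | b < q}) := by
  obtain ⟨ρ, hρ, m1, m2, hs⟩ := circEnd.exists_rotation
  obtain ⟨a, ha, b, hb, hab⟩ := (isGap_rat_lt irrational_sqrt_two).exists_collapsible (ρ • w)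
  have hρρ : ∀ q, ρ.1 (ρ.1 q) = q := fun q => congrFun (congrArg Subtype.val hρ) q
  have hL := isGap_rat_lt irrational_sqrt_two
  change (a : ℝ) < √2 at ha
  change ¬ (b : ℝ) < √2 at hb
  have hρa : ¬ (ρ.1 a : ℝ) < √2 := fun h => (hs a).1 h ha
  have hρb : (ρ.1 b : ℝ) < √2 := (hs b).2 hb
  refine ⟨ρ.1 b, ρ.1 a, (hab.preimage hρ).mono ?_⟩
  rintro q (hq | hq)
  · have hq' : (q : ℝ) < √2 := hL.lower (le_of_lt hq) hρb
    refine ⟨hL.lt_of_mem_of_notMem ha fun h => (hs q).1 h hq', ?_⟩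
    have := m1 q _ hq' hρb hq
    rwa [hρρ] at this
  · have hq' : ¬ (q : ℝ) < √2 := fun h => hρa (hL.lower (le_of_lt hq) h)
    refine ⟨?_, hL.lt_of_mem_of_notMem ((hs q).2 hq') hb⟩
    have := m2 _ q hρa hq' hq
    rwa [hρρ] at this

theorem exists_nhds_collapsible (w : Ω) (x : ℝ) :
    ∃ U ∈ nhds x, Collapsible w {q : ℚ | (q : ℝ) ∈ U} := by
  obtain ⟨p, hp⟩ := exists_rat_lt x
  obtain ⟨r, hr⟩ := exists_rat_gt x
  obtain ⟨a, ha, b, hb, hab⟩ := exists_collapsible_of_isLowerSet (K := {q : ℚ | (q : ℝ) < x})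
    (fun q q' h (hq : (q : ℝ) < x) => lt_of_le_of_lt (Rat.cast_le.2 h) hq) ⟨p, hp⟩
    ⟨r, fun h : (r : ℝ) < x => lt_asymm h hr⟩ w
  obtain ⟨a', ha', b', hb', hab'⟩ := exists_collapsible_of_isLowerSet (K := {q : ℚ | (q : ℝ) ≤ x})
    (fun q q' h (hq : (q : ℝ) ≤ x) => le_trans (Rat.cast_le.2 h) hq) ⟨p, hp.le⟩
    ⟨r, fun h : (r : ℝ) ≤ x => h.not_gt hr⟩ w
  change (a : ℝ) < x at ha
  change ¬ (b : ℝ) < x at hb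
  change (a' : ℝ) ≤ x at ha'
  change ¬ (b' : ℝ) ≤ x at hb'
  have hx : {q : ℚ | (q : ℝ) = x}.Finite :=
    Set.Subsingleton.finite fun q hq q' hq' => by
      have : (q : ℝ) = q' := Eq.trans hq (Eq.symm hq')
      exact_mod_cast this
  refine ⟨Ioo a b', Ioo_mem_nhds ha (not_le.1 hb'),
    ((hab.union hab').union (.of_finite hx)).mono ?_⟩
  rintro q ⟨h1, h2⟩
  have h1 : a < q := by exact_mod_cast h1
  have h2 : q < b' := by exact_mod_cast h2
  rcases lt_trichotomy (q : ℝ) x with h | h | h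
  · exact Or.inl (Or.inl ⟨h1, by exact_mod_cast h.trans_le (not_lt.1 hb)⟩)
  · exact Or.inr h
  · exact Or.inl (Or.inr ⟨by exact_mod_cast ha'.trans_lt h, h2⟩)

/-- Every element of a countable `circEnd`-set is fixed by an endomorphism of finite range. -/
theorem exists_smul_eq_finite_range (w : Ω) :
    ∃ e : circEnd, e • w = w ∧ (range e.1).Finite := by
  obtain ⟨a, b, hab⟩ := exists_collapsible_at_infinity w
  have hc : Collapsible w {q : ℚ | (q : ℝ) ∈ Icc (a : ℝ) b} := by
    refine isCompact_Icc.induction_on (p := fun U => Collapsible w {q : ℚ | (q : ℝ) ∈ U})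
      (.of_finite (by simp)) (fun U U' h hU => hU.mono fun q hq => h hq)
      (fun U U' hU hU' => hU.union hU') fun x _ => ?_
    obtain ⟨U, hU, h⟩ := exists_nhds_collapsible w x
    exact ⟨U, mem_nhdsWithin_of_mem_nhds hU, h⟩
  obtain ⟨e, he, Φ, hΦ, -, h⟩ := hab.union hc
  refine ⟨e, he, hΦ.subset ?_⟩
  rintro _ ⟨q, rfl⟩
  refine h q ?_
  rcases lt_or_ge q a with h1 | h1
  · exact Or.inl (Or.inl h1)
  rcases lt_or_ge b q with h2 | h2
  · exact Or.inl (Or.inr h2)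
  · exact Or.inr ⟨by exact_mod_cast h1, by exact_mod_cast h2⟩

end Action

/-! ### Topology of operation clones -/

namespace Op

variable {A : Type u} {n : ℕ}

lemma isOpen_setOf_apply_eq (a : Fin n → A) (b : A) : IsOpen {f : Op A n | f a = b} := by
  let : TopologicalSpace A := ⊥
  have : DiscreteTopology A := ⟨rfl⟩
  exact (isOpen_discrete {b}).preimage (continuous_apply (A := fun _ : Fin n → A => A) a)

lemma continuous_of_isOpen {X : Type*} [TopologicalSpace X] {F : X → Op A n}
    (h : ∀ a b, IsOpen {x | F x a = b}) : Continuous F := by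
  let : TopologicalSpace A := ⊥
  have : DiscreteTopology A := ⟨rfl⟩
  refine continuous_pi (A := fun _ : Fin n → A => A) fun a => ?_
  exact continuous_discrete_rng.2 fun b => h a b

end Op

namespace OpClone

variable {A : Type u} {B : Type v} {C : OpClone A} {D : OpClone B}

lemma Iso.isHomeomorph (θ : C.Iso D) (h1 : ∀ n, Continuous (θ.toEquiv n))
    (h2 : ∀ n, Continuous (θ.toEquiv n).symm) : IsHomeomorph θ.toFun where
  continuous := Continuous.sigma_map h1
  isOpenMap := isOpenMap_sigma_map.2 fun n U hU => by
    rw [Equiv.image_eq_preimage_symm]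
    exact hU.preimage (h2 n)
  bijective := ⟨Function.injective_id.sigma_map fun n => (θ.toEquiv n).injective,
    Function.surjective_id.sigma_map fun n => (θ.toEquiv n).surjective⟩

lemma Iso.toEquiv_comp_apply (θ : C.Iso D) {n m : ℕ} (f : C.ops n) (g : Fin n → C.ops m)
    (w : Fin m → B) :
    (θ.toEquiv m ⟨Op.comp f.1 (fun i => (g i).1), C.comp_mem f.2 (fun i => (g i).2)⟩).1 w =
      (θ.toEquiv n f).1 fun i => (θ.toEquiv m (g i)).1 w := by
  rw [θ.map_comp]
  rfl

/-- The inverse of an isomorphism is continuous if the clone contains all nullary operations. -/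
lemma Iso.continuous_symm (θ : C.Iso D) (hC : ∀ f : Op A 0, f ∈ C.ops 0) (n : ℕ) :
    Continuous (θ.toEquiv n).symm := by
  let c : A → C.ops 0 := fun a => ⟨fun _ => a, hC _⟩
  let γ : A → B := fun a => (θ.toEquiv 0 (c a)).1 Fin.elim0
  have hγ : Function.Injective γ := by
    intro a b hab
    have h : θ.toEquiv 0 (c a) = θ.toEquiv 0 (c b) :=
      Subtype.ext (funext fun w => by rw [Subsingleton.elim w Fin.elim0]; exact hab)
    exact congrFun (congrArg Subtype.val ((θ.toEquiv 0).injective h)) Fin.elim0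
  have key : ∀ (f : C.ops n) (a : Fin n → A), (θ.toEquiv n f).1 (fun i => γ (a i)) = γ (f.1 a) :=
    fun f a => (θ.toEquiv_comp_apply f (fun i => c (a i)) Fin.elim0).symm
  refine Continuous.subtype_mk (Op.continuous_of_isOpen fun a b => ?_) _
  have : {d : D.ops n | ((θ.toEquiv n).symm d).1 a = b} =
      Subtype.val ⁻¹' {d : Op B n | d (fun i => γ (a i)) = γ b} := by
    ext d
    obtain ⟨f, rfl⟩ := (θ.toEquiv n).surjective d
    simp only [mem_ofPred_eq, mem_preimage, Equiv.symm_apply_apply, key, hγ.eq_iff]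
  exact this ▸ (Op.isOpen_setOf_apply_eq _ _).preimage continuous_subtype_val

section Circ

variable {C : OpClone ℚ}

/-- An endomorphism of the circular order as a unary member of a clone. -/
def unary (hC : ∀ e : circEnd, (fun a => e.1 (a 0) : Op ℚ 1) ∈ C.ops 1) (e : circEnd) : C.ops 1 :=
  ⟨fun a => e.1 (a 0), hC e⟩

/-- The action of the endomorphisms of the circular order induced by a clone isomorphism. -/
abbrev Iso.mulAction (θ : C.Iso D) (hC : ∀ e : circEnd, (fun a => e.1 (a 0) : Op ℚ 1) ∈ C.ops 1) :
    MulAction circEnd B where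
  smul e w := (θ.toEquiv 1 (unary hC e)).1 fun _ => w
  one_smul w := congrFun (congrArg Subtype.val (θ.map_proj (0 : Fin 1))) fun _ => w
  mul_smul e e' w := θ.toEquiv_comp_apply (unary hC e) (fun _ => unary hC e') fun _ => w

theorem Iso.continuous_toEquiv [Countable B] (θ : C.Iso D)
    (hC : ∀ e : circEnd, (fun a => e.1 (a 0) : Op ℚ 1) ∈ C.ops 1) (n : ℕ) :
    Continuous (θ.toEquiv n) := by
  let := θ.mulAction hC
  choose e he hfin using fun w : B => exists_smul_eq_finite_range w
  have key : ∀ (f g : C.ops n) (w : Fin n → B),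
      (∀ a ∈ Set.univ.pi fun i => range (e (w i)).1, f.1 a = g.1 a) →
      (θ.toEquiv n f).1 w = (θ.toEquiv n g).1 w := by
    intro f g w hfg
    let p : Fin n → C.ops n := fun i => ⟨Op.proj ℚ i, C.proj_mem i⟩
    let r : Fin n → C.ops n := fun i => ⟨Op.comp (unary hC (e (w i))).1 fun _ => (p i).1,
      C.comp_mem (unary hC (e (w i))).2 fun _ => (p i).2⟩
    have hr : ∀ i, (θ.toEquiv n (r i)).1 w = w i := fun i => by
      rw [θ.toEquiv_comp_apply (unary hC (e (w i))) (fun _ => p i) w, θ.map_proj]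
      exact he (w i)
    have h : ∀ f : C.ops n, (θ.toEquiv n f).1 w =
        (θ.toEquiv n ⟨Op.comp f.1 fun i => (r i).1, C.comp_mem f.2 fun i => (r i).2⟩).1 w :=
      fun f => by rw [θ.toEquiv_comp_apply f r w]; simp only [hr]
    have hr' : (⟨Op.comp f.1 fun i => (r i).1, C.comp_mem f.2 fun i => (r i).2⟩ : C.ops n) =
        ⟨Op.comp g.1 fun i => (r i).1, C.comp_mem g.2 fun i => (r i).2⟩ :=
      Subtype.ext (funext fun a => hfg _ fun i _ => ⟨a i, rfl⟩)
    rw [h f, h g, hr']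
  have hcont : Continuous fun f => (θ.toEquiv n f).1 := by
    refine Op.continuous_of_isOpen fun w b => isOpen_iff_forall_mem_open.2 fun f hf => ?_
    refine ⟨⋂ a ∈ Set.univ.pi fun i => range (e (w i)).1,
      Subtype.val ⁻¹' {g : Op ℚ n | g a = f.1 a}, fun g hg => ?_, ?_, ?_⟩
    · rw [mem_iInter₂] at hg
      exact (key g f w hg).trans hf
    · exact (Set.Finite.pi fun i => hfin (w i)).isOpen_biInter fun a _ =>
        (Op.isOpen_setOf_apply_eq _ _).preimage continuous_subtype_val
    · exact mem_iInter₂.2 fun a _ => rfl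
  exact hcont.subtype_mk fun f => (θ.toEquiv n f).2

/-- A clone on `ℚ` that contains the constants and the endomorphisms of the circular order has
automatic homeomorphicity. -/
theorem hasAutomaticHomeomorphicity_of_circEnd
    (h0 : ∀ f : Op ℚ 0, f ∈ C.ops 0)
    (h1 : ∀ e : circEnd, (fun a => e.1 (a 0) : Op ℚ 1) ∈ C.ops 1) :
    HasAutomaticHomeomorphicity.{0, v} C :=
  fun _ _ _ _ θ => θ.isHomeomorph (θ.continuous_toEquiv h1) (θ.continuous_symm h0)

end Circ

end OpClone

lemma circ_refl (x : ℚ) : circ x x x := Or.inl ⟨le_rfl, le_rfl⟩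

lemma sep_refl (x : ℚ) : sep x x x x := Or.inl ⟨circ_refl x, circ_refl x⟩

theorem theorem5p2 :
    OpClone.HasAutomaticHomeomorphicity.{0, v} polCirc ∧
      OpClone.HasAutomaticHomeomorphicity.{0, v} polSep := by
  constructor
  · refine OpClone.hasAutomaticHomeomorphicity_of_circEnd (fun f a _ => ?_)
      fun e a h => e.2 _ _ _ (h 0)
    have : ∀ i, a i = Fin.elim0 := fun i => Subsingleton.elim _ _
    simpa only [this] using circ_refl _
  · refine OpClone.hasAutomaticHomeomorphicity_of_circEnd (fun f a _ => ?_) fun e a h => ?_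
    · have : ∀ i, a i = Fin.elim0 := fun i => Subsingleton.elim _ _
      simpa only [this] using sep_refl _
    · exact (h 0).imp (fun h => ⟨e.2 _ _ _ h.1, e.2 _ _ _ h.2⟩)
        fun h => ⟨e.2 _ _ _ h.1, e.2 _ _ _ h.2⟩
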